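/- **Up-down run generation with a $2M$-slot buffer.** Let $M\ge 1$ and let $I$ be a finite sequence of elements of a linearly ordered set. *Outputs and OPT.* An algorithm with an $M$-slot buffer *reads* the elements of $I$ in order into free buffer slots and *writes* elements by ejecting them from the buffer and appending them to the output, until all elements of $I$ have been written. A *run* is a sorted or reverse-sorted sequence, and $R(S)$ is the least number of runs whose concatenation is $S$. Let $\mathrm{OPT}_M(I)$ be the minimum of $R(S)$ over all outputs $S$ that can be produced from $I$ in this way with an $M$-slot buffer (by an offline algorithm that knows $I$). *Online algorithms.* A randomized online algorithm with a $b$-slot buffer has $b$ slots, each of which is free or holds an element, and a finite set of internal states. At each step it chooses its next command at random, with a distribution that depends only on the current contents of the buffer, the last element written, and the internal state. The command is to read the next input element into a free slot (learning if the input is exhausted), to write an element of the buffer (which frees its slot), to rearrange the buffer (permute, clear or copy slots, never using more than $b$), or to halt; the internal state is updated at the same time. **Theorem.** For every linearly ordered set there is a family of randomized online algorithms $(A_M)_{M\ge 1}$, where $A_M$ has a $2M$-slot buffer and $o(M)$ bits of internal state as $M\to\infty$, such that for every $M\ge 1$ and every finite input $I$ without duplicate elements, $A_M$ halts on every outcome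 of its random choices, after a bounded number of steps, with an output $S$ that is a rearrangement of all of $I$ and satisfies $$\mathbb{E}[R(S)]\le \tfrac74\,\mathrm{OPT}_M(I)\qquad\text{and, on every outcome,}\qquad R(S)\le 2\,\mathrm{OPT}_M(I).$$ -/

import Mathlib

open scoped ENNReal

namespace RunGen

section Runs

variable {α : Type*} [LinearOrder α]

/-- A run is a sorted or reverse-sorted sequence. -/
def IsRun (l : List α) : Prop :=
  l.Pairwise (· ≤ ·) ∨ l.Pairwise (· ≥ ·)

/-- The smallest number of runs whose concatenation is `S`. -/
noncomputable def numRuns (S : List α) : ℕ :=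
  sInf {k | ∃ parts : List (List α),
    parts.length = k ∧ parts.flatten = S ∧ ∀ p ∈ parts, IsRun p}

/-- `CanOutput M B I S`: starting with buffer contents `B` (a buffer with `M` slots) and remaining
input `I`, some sequence of reads and writes empties input and buffer and writes exactly `S`. -/
inductive CanOutput (M : ℕ) : Multiset α → List α → List α → Prop
  | done : CanOutput M 0 [] []
  | read {B : Multiset α} {x : α} {I S : List α} :
      B.card < M → CanOutput M (x ::ₘ B) I S → CanOutput M B (x :: I) S
  | write {B : Multiset α} {x : α} {I S : List α} :
      CanOutput M B I S → CanOutput M (x ::ₘ B) I (x :: S)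

/-- The minimum number of runs of any output that is possible on input `I` with an `M`-slot
buffer (the optimum of an offline algorithm). -/
noncomputable def opt (M : ℕ) (I : List α) : ℕ :=
  sInf {k | ∃ S : List α, CanOutput M 0 I S ∧ numRuns S = k}

end Runs

/-- The elementary commands of an online algorithm with internal states `Q`. -/
inductive Command (α : Type*) (Q : Type)
  /-- Move the next input element to a free buffer slot and go to the first state; if the input
  turns out to be exhausted, go to the second state. -/
  | read (next atEnd : Q)
  /-- Eject `x` from its buffer slot and append it to the output. -/
  | write (x : α) (next : Q)
  /-- Overwrite the buffer slots with the list `l` of elements that are in the buffer: this can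
  permute the slots, clear some of them, and copy an element to a free slot. -/
  | rearrange (l : List α) (next : Q)
  /-- Stop. -/
  | halt

/-- A randomized online algorithm with `b` buffer slots. The (random) next command depends on
the contents of the buffer, the last element written, and the internal state only. -/
structure OnlineAlg (α : Type*) (b : ℕ) where
  State : Type
  [fintypeState : Fintype State]
  start : State
  act : List α → Option α → State → PMF (Command α State)

attribute [instance] OnlineAlg.fintypeState

/-- A snapshot of an execution: the elements not yet read, the occupied buffer slots, the output
so far, and the internal state. -/
structure Config (α : Type*) (Q : Type) where
  input : List α
  buffer : List α
  output : List α
  state : Q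
  halted : Bool

section Exec

variable {α : Type*} [LinearOrder α]

/-- The effect of a command with `b` buffer slots; a command that is not applicable
(reading without a free slot, writing an element that is not in the buffer, or rearranging the
buffer into something with other elements or with too many slots) has no effect. -/
def exec {Q : Type} (b : ℕ) (c : Config α Q) : Command α Q → Config α Q
  | .read next atEnd =>
      if c.buffer.length < b then
        match c.input with
        | [] => { c with state := atEnd }
        | x :: I => { c with input := I, buffer := c.buffer ++ [x], state := next }
      else c
  | .write x next =>
      if x ∈ c.buffer then
        { c with buffer := c.buffer.erase x, output := c.output ++ [x], state := next }
      else c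
  | .rearrange l next =>
      if (∀ x ∈ l, x ∈ c.buffer) ∧ l.length ≤ b then
        { c with buffer := l, state := next }
      else c
  | .halt => { c with halted := true }

namespace OnlineAlg

variable {b : ℕ} (A : OnlineAlg α b)

/-- One step of the algorithm, with fresh randomness. -/
noncomputable def step (c : Config α A.State) : PMF (Config α A.State) :=
  if c.halted then PMF.pure c
  else (A.act c.buffer c.output.getLast? c.state).map (exec b c)

/-- The law of the configuration after `t` steps on input `I`. -/
noncomputable def law (I : List α) : ℕ → PMF (Config α A.State)
  | 0 => PMF.pure ⟨I, [], [], A.start, false⟩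
  | t + 1 => (law I t).bind A.step

/-- On input `I`, the algorithm halts on every outcome (after a bounded number of steps), and the
law of its output is `p`. -/
def HasOutputLaw (I : List α) (p : PMF (List α)) : Prop :=
  ∃ t : ℕ, (∀ c ∈ (A.law I t).support, c.halted = true) ∧ p = (A.law I t).map Config.output

end OnlineAlg

end Exec

end RunGen

/-!
If a buffer with `N` slots is kept full, it holds the first `N` elements of the sequence `J` of
all elements not yet written, and a write deletes one of these from `J`. The greedy run in a given
direction always takes the closest element that still fits. It is best possible in a strong sense
(`Greedy.sublist_of_del`): from `J` it deletes everything that any run in this direction with `M`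
slots deletes from a sequence `K`, if `J` is a subsequence of `K` apart from a few additional
elements at its start for which there are `N - M` additional slots.

The algorithm works in blocks. It tosses a coin for a direction `c`, writes the greedy run in
direction `c` with `M` slots, and uses the other `M` slots to simulate the greedy run in the
opposite direction.

* If the simulated run does not outlast the real one, or the input is exhausted before either of
  them ends, the block goes on with an opposite run with all `2 * M` slots and another run in
  direction `c`. These three runs achieve what any two runs with `M` slots achieve
  (`sublist_of_three_runs`). The critical case is that of two runs opposite to `c`. Then the
  elements that the first of these has written and the run in direction `c` has not are all among
  the `M` elements with which the latter got stuck, and there is space for them in the second run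
  of the block.
* Otherwise the simulated run outlasts the real one, and three more runs in alternating directions
  follow. Each of the two pairs of opposite runs achieves what any one run achieves
  (`sublist_of_two_runs`).

So a block writes at most four runs in place of two of an optimal solution, and since the second
case cannot occur for both outcomes of the coin, it writes at most `7 / 2` on average. If a single
run of the optimal solution is left, the block writes one run with probability at least `1 / 2` and
never more than two.

The slots suffice for the simulation: after both runs have written an element, the real run needs
`M - 1` slots, and the simulated run needs `M - 1` and one for the last element written. The next
input element takes the last slot and is copied over the last element of the simulated run once the
two have been compared. Which elements belong to which run is determined by their positions, so
that the number of internal states does not depend on `M`.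
-/

namespace RunGen

section Combinatorics

variable {α : Type*} [LinearOrder α]

/-! ### Greedy runs on the sequence of unwritten elements -/

/-- `dle up` is `≤` for ascending runs (`up = true`) and `≥` for descending ones. -/
def dle (up : Bool) (x y : α) : Prop := if up then x ≤ y else y ≤ x

/-- `x` may extend a run in direction `up` whose last element is `o` (`none` for an empty run). -/
def Fits (up : Bool) (o : Option α) (x : α) : Prop := ∀ y ∈ o, dle up y x

theorem dle_refl (up : Bool) (x : α) : dle up x x := by cases up <;> simp [dle]

theorem dle_trans {up : Bool} {x y z : α} (h : dle up x y) (h' : dle up y z) : dle up x z := by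
  cases up <;> simp only [dle] at * <;> simp at * <;> order

theorem dle_total (up : Bool) (x y : α) : dle up x y ∨ dle up y x := by
  cases up <;> simp only [dle] <;> simp <;> exact le_total _ _

theorem dle_antisymm {up : Bool} {x y : α} (h : dle up x y) (h' : dle up y x) : x = y := by
  cases up <;> simp only [dle] at * <;> simp at * <;> order

@[simp] theorem fits_none (up : Bool) (x : α) : Fits up none x := by simp [Fits]

@[simp] theorem fits_some {up : Bool} {x y : α} : Fits up (some y) x ↔ dle up y x := by simp [Fits]

/-- `x` is the element with which a greedy run in direction `up` with last element `o` goes on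
when the elements of `W` are available. -/
def IsPick (up : Bool) (o : Option α) (W : List α) (x : α) : Prop :=
  x ∈ W ∧ Fits up o x ∧ ∀ y ∈ W, Fits up o y → dle up x y

theorem IsPick.unique {up : Bool} {o : Option α} {W : List α} {x y : α}
    (hx : IsPick up o W x) (hy : IsPick up o W y) : x = y :=
  dle_antisymm (hx.2.2 y hy.1 hy.2.1) (hy.2.2 x hx.1 hx.2.1)

theorem exists_isPick {up : Bool} {o : Option α} {W : List α}
    (h : ∃ x ∈ W, Fits up o x) : ∃ x, IsPick up o W x := by
  induction W with
  | nil => simp at h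
  | cons a W ih =>
    by_cases hW : ∃ x ∈ W, Fits up o x
    · obtain ⟨x, hx, hox, hmin⟩ := ih hW
      by_cases ha : Fits up o a ∧ dle up a x
      · refine ⟨a, by simp, ha.1, fun y hy hoy => ?_⟩
        rcases List.mem_cons.1 hy with rfl | hy
        · exact dle_refl _ _
        · exact dle_trans ha.2 (hmin y hy hoy)
      · refine ⟨x, by simp [hx], hox, fun y hy hoy => ?_⟩
        rcases List.mem_cons.1 hy with rfl | hy
        · exact (dle_total up x y).resolve_right fun h => ha ⟨hoy, h⟩
        · exact hmin y hy hoy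
    · obtain ⟨x, hx, hox⟩ := h
      rcases List.mem_cons.1 hx with rfl | hx
      · refine ⟨x, by simp, hox, fun y hy hoy => ?_⟩
        rcases List.mem_cons.1 hy with rfl | hy
        · exact dle_refl _ _
        · exact absurd ⟨y, hy, hoy⟩ hW
      · exact absurd ⟨x, hx, hox⟩ hW

open Classical in
/-- The element with which a greedy run goes on, or `none` if the run is over. -/
noncomputable def pick (up : Bool) (o : Option α) (W : List α) : Option α :=
  if h : ∃ x, IsPick up o W x then some h.choose else none

theorem pick_eq_some {up : Bool} {o : Option α} {W : List α} {x : α} (h : IsPick up o W x) :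
    pick up o W = some x := by
  have hex : ∃ x, IsPick up o W x := ⟨x, h⟩
  rw [pick, dif_pos hex, hex.choose_spec.unique h]

theorem pick_eq_none {up : Bool} {o : Option α} {W : List α} (h : ∀ x ∈ W, ¬ Fits up o x) :
    pick up o W = none := by
  rw [pick, dif_neg]
  rintro ⟨x, hx⟩
  exact h x hx.1 hx.2.1

/-- `Greedy N up o J w r`: when `J` is the sequence of the elements not yet written, and a buffer
with `N` slots is kept full, so that it holds the first `N` elements of `J`, then the greedy run in
direction `up` whose last element is `o` goes on with `w` and leaves `r`. -/
inductive Greedy (N : ℕ) (up : Bool) : Option α → List α → List α → List α → Prop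
  | finished {o : Option α} {J : List α} : (∀ x ∈ J.take N, ¬ Fits up o x) → Greedy N up o J [] J
  | step {o : Option α} {J w r : List α} {x : α} :
      IsPick up o (J.take N) x → Greedy N up (some x) (J.erase x) w r → Greedy N up o J (x :: w) r

theorem exists_greedy (N : ℕ) (up : Bool) (o : Option α) (J : List α) :
    ∃ w r, Greedy N up o J w r := by
  induction hn : J.length generalizing o J with
  | zero => exact ⟨[], J, .finished (by simp [List.length_eq_zero_iff.1 hn])⟩
  | succ n ih =>
    by_cases h : ∃ x ∈ J.take N, Fits up o x
    · obtain ⟨x, hx⟩ := exists_isPick h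
      obtain ⟨w, r, hwr⟩ := ih (some x) (J.erase x)
        (by rw [List.length_erase_of_mem (List.mem_of_mem_take hx.1), hn]; rfl)
      exact ⟨_, _, .step hx hwr⟩
    · push Not at h
      exact ⟨_, _, .finished h⟩

theorem Greedy.unique {N : ℕ} {up : Bool} {o : Option α} {J w r w' r' : List α}
    (h : Greedy N up o J w r) (h' : Greedy N up o J w' r') : w = w' ∧ r = r' := by
  induction h generalizing w' with
  | finished h =>
    cases h' with
    | finished => simp
    | step hx => exact absurd hx.2.1 (h _ hx.1)
  | step hx _ ih =>
    cases h' with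
    | finished h => exact absurd hx.2.1 (h _ hx.1)
    | step hx' h' =>
      obtain rfl := hx.unique hx'
      obtain ⟨rfl, rfl⟩ := ih h'
      simp

theorem Greedy.perm {N : ℕ} {up : Bool} {o : Option α} {J w r : List α}
    (h : Greedy N up o J w r) : (w ++ r).Perm J := by
  induction h with
  | finished => simp
  | step hx _ ih => exact (ih.cons _).trans (List.perm_cons_erase (List.mem_of_mem_take hx.1)).symm

theorem Greedy.sublist {N : ℕ} {up : Bool} {o : Option α} {J w r : List α}
    (h : Greedy N up o J w r) : r.Sublist J := by
  induction h with
  | finished => simp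
  | step hx _ ih => exact ih.trans List.erase_sublist

theorem Greedy.fits {N : ℕ} {up : Bool} {o : Option α} {J w r : List α}
    (h : Greedy N up o J w r) : ∀ x ∈ w, Fits up o x := by
  induction h with
  | finished => simp
  | @step o J w r x hx _ ih =>
    intro y hy
    rcases List.mem_cons.1 hy with rfl | hy
    · exact hx.2.1
    · exact fun z hz => dle_trans (hx.2.1 z hz) (fits_some.1 (ih y hy))

theorem Greedy.pairwise {N : ℕ} {up : Bool} {o : Option α} {J w r : List α}
    (h : Greedy N up o J w r) : w.Pairwise (dle up) := by
  induction h with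
  | finished => simp
  | step _ h ih => exact List.pairwise_cons.2 ⟨fun y hy => fits_some.1 (h.fits y hy), ih⟩

theorem isRun_iff {l : List α} : IsRun l ↔ ∃ up, l.Pairwise (dle up) := by
  rw [Bool.exists_bool, or_comm]
  rfl

/-- The elements of `J` before (the first occurrence of) `z`. -/
def before (J : List α) (z : α) : Finset α := (J.takeWhile (· ≠ z)).toFinset

theorem before_cons (a : α) (J : List α) (z : α) :
    before (a :: J) z = if a = z then ∅ else insert a (before J z) := by
  by_cases h : a = z <;> simp [before, h]

theorem before_erase {J : List α} (hJ : J.Nodup) {x z : α} (h : x ≠ z) :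
    before (J.erase x) z = (before J z).erase x := by
  induction J with
  | nil => simp [before]
  | cons a J ih =>
    have hJ' := List.nodup_cons.1 hJ
    by_cases hax : a = x
    · subst hax
      have : a ∉ before J z := fun hm => hJ'.1 <| by
        simp only [before, List.mem_toFinset] at hm
        exact (List.takeWhile_sublist _).subset hm
      simp [before_cons, h, this]
    · rw [List.erase_cons_tail (by simpa using hax), before_cons, before_cons, ih hJ'.2]
      split_ifs
      · simp
      · rw [Finset.erase_insert_of_ne hax]

theorem card_before_of_notMem_take {J : List α} (hJ : J.Nodup) {N : ℕ} {z : α} (hz : z ∈ J)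
    (h : z ∉ J.take N) : N ≤ (before J z).card := by
  induction J generalizing N with
  | nil => simp at hz
  | cons a J ih =>
    cases N with
    | zero => simp
    | succ N =>
      simp only [List.take_succ_cons, List.mem_cons, not_or] at h
      have hJ' := List.nodup_cons.1 hJ
      rw [before_cons, if_neg (Ne.symm h.1), Finset.card_insert_of_notMem]
      · exact Nat.succ_le_succ (ih hJ'.2 ((List.mem_cons.1 hz).resolve_left h.1) h.2)
      · intro hm
        simp only [before, List.mem_toFinset] at hm
        exact hJ'.1 ((List.takeWhile_sublist _).subset hm)

theorem card_before_lt_of_mem_take {J : List α} {N : ℕ} {z : α} (h : z ∈ J.take N) :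
    (before J z).card < N := by
  induction J generalizing N with
  | nil => simp at h
  | cons a J ih =>
    cases N with
    | zero => simp at h
    | succ N =>
      rw [before_cons]
      split_ifs with haz
      · simp
      · have := ih ((List.mem_cons.1 h).resolve_left (Ne.symm haz))
        exact (Finset.card_insert_le _ _).trans_lt (by omega)

theorem before_subset_of_sublist {J K : List α} (h : J.Sublist K) (hK : K.Nodup) {z : α}
    (hz : z ∈ J) : before J z ⊆ before K z := by
  induction h with
  | slnil => simp
  | @cons J K a h ih =>
    have hK' := List.nodup_cons.1 hK
    rw [before_cons, if_neg]
    · exact (ih hK'.2 hz).trans (Finset.subset_insert _ _)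
    · rintro rfl
      exact hK'.1 (h.subset hz)
  | @cons_cons J K a h ih =>
    rw [before_cons, before_cons]
    split_ifs with haz
    · simp
    · exact Finset.insert_subset_insert _
        (ih (List.nodup_cons.1 hK).2 ((List.mem_cons.1 hz).resolve_left (Ne.symm haz)))

theorem before_filter {J : List α} {P : α → Prop} [DecidablePred P] {z : α} (hz : P z) :
    before (J.filter P) z = (before J z).filter P := by
  induction J with
  | nil => simp [before]
  | cons a J ih =>
    by_cases ha : P a
    · rw [List.filter_cons_of_pos (by simpa using ha), before_cons, before_cons, ih]
      split_ifs
      · simp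
      · rw [Finset.filter_insert, if_pos ha]
    · have : a ≠ z := fun h => ha (h ▸ hz)
      rw [List.filter_cons_of_neg (by simpa using ha), before_cons, if_neg this,
        Finset.filter_insert, if_neg ha, ih]

/-- An element that would have fitted into a greedy run but was left behind never came into the
window: at least `N` elements precede it even if the smaller written ones are not counted. -/
theorem Greedy.le_card_before {N : ℕ} {up : Bool} {o : Option α} {J w r : List α}
    (h : Greedy N up o J w r) (hJ : J.Nodup) {z : α} (hz : z ∈ r) (hoz : Fits up o z)
    {A : Finset α} (hA : ∀ y ∈ A, y ∈ w ∧ dle up y z) : N ≤ (before J z \ A).card := by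
  induction h generalizing A with
  | @finished o J h =>
    have hA' : A = ∅ := Finset.eq_empty_of_forall_notMem fun y hy => by simpa using (hA y hy).1
    subst hA'
    simpa using card_before_of_notMem_take hJ hz fun hz' => h z hz' hoz
  | @step o J w r x hx h ih =>
    have hzx : x ≠ z := by
      rintro rfl
      exact hJ.not_mem_erase (h.sublist.subset hz)
    by_cases hxz : dle up x z
    · have key := @ih (hJ.erase x) hz (by simpa using hxz) (A.erase x) fun y hy => by
        have hy' := Finset.mem_erase.1 hy
        have := hA y hy'.2
        exact ⟨(List.mem_cons.1 this.1).resolve_left hy'.1, this.2⟩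
      refine key.trans (Finset.card_le_card ?_)
      rw [before_erase hJ hzx]
      intro y
      simp only [Finset.mem_sdiff, Finset.mem_erase]
      tauto
    · have hA' : A = ∅ := Finset.eq_empty_of_forall_notMem fun y hy => by
        obtain ⟨hyw, hyz⟩ := hA y hy
        rcases List.mem_cons.1 hyw with rfl | hyw
        · exact hxz hyz
        · exact hxz (dle_trans (fits_some.1 (h.fits y hyw)) hyz)
      subst hA'
      simpa using card_before_of_notMem_take hJ (List.mem_of_mem_erase (h.sublist.subset hz))
        fun hz' => hxz (hx.2.2 z hz' hoz)

/-- A greedy run from scratch writes everything that is in the window at its start. -/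
theorem Greedy.notMem_take {N : ℕ} {up : Bool} {J w r : List α}
    (h : Greedy N up none J w r) (hJ : J.Nodup) {z : α} (hz : z ∈ r) : z ∉ J.take N := fun hz' => by
  have h1 := h.le_card_before hJ hz (fits_none up z) (A := ∅) (by simp)
  have h2 := card_before_lt_of_mem_take hz'
  simp at h1
  omega

theorem Greedy.le_length {N : ℕ} {up : Bool} {J w r : List α}
    (h : Greedy N up none J w r) (hJ : J.Nodup) : min N J.length ≤ w.length := by
  have hsub : J.take N ⊆ w := fun z hz => by
    have := h.perm.symm.subset (List.mem_of_mem_take hz)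
    rcases List.mem_append.1 this with hw | hr
    · exact hw
    · exact absurd hz (h.notMem_take hJ hr)
  have := (List.subperm_of_subset (hJ.sublist (List.take_sublist _ _)) hsub).length_le
  simpa using this

/-! ### Arbitrary runs and their comparison with greedy ones -/

/-- `Del M K v r`: from the sequence `K` of unwritten elements, a buffer with `M` slots allows to
write `v`, leaving `r`; each element written is one of the first `M`. -/
inductive Del (M : ℕ) : List α → List α → List α → Prop
  | nil {K : List α} : Del M K [] K
  | cons {K v r : List α} {x : α} : x ∈ K.take M → Del M (K.erase x) v r → Del M K (x :: v) r

theorem Del.eq_filter {M : ℕ} {K v r : List α} (h : Del M K v r) (hK : K.Nodup) :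
    r = K.filter (· ∉ v) := by
  induction h with
  | nil => simp
  | @cons K v r x _ _ ih =>
    rw [ih (hK.erase x), hK.erase_eq_filter, List.filter_filter]
    congr 1
    ext y
    by_cases h1 : y = x <;> by_cases h2 : y ∈ v <;> simp [h1, h2]

theorem Del.card_before_lt {M : ℕ} {K v r : List α} (h : Del M K v r) (hK : K.Nodup)
    {v₁ v₂ : List α} {z : α} (hv : v = v₁ ++ z :: v₂) (hz : z ∉ v₁) :
    (before K z \ v₁.toFinset).card < M := by
  induction h generalizing v₁ with
  | nil => simp at hv
  | @cons K v r x hx h ih =>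
    cases v₁ with
    | nil =>
      obtain ⟨rfl, rfl⟩ : x = z ∧ v = v₂ := by simpa using hv
      simpa using card_before_lt_of_mem_take hx
    | cons a v₁ =>
      obtain ⟨rfl, rfl⟩ : x = a ∧ v = v₁ ++ z :: v₂ := by simpa using hv
      have hz' := not_or.1 (mt List.mem_cons.2 hz)
      have := ih (hK.erase x) rfl hz'.2
      rw [before_erase hK (Ne.symm hz'.1)] at this
      refine lt_of_eq_of_lt (congrArg _ ?_) this
      ext y
      simp only [List.toFinset_cons, Finset.mem_sdiff, Finset.mem_insert, Finset.mem_erase]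
      tauto

theorem Del.split {M : ℕ} {K v₁ v₂ r : List α} (h : Del M K (v₁ ++ v₂) r) :
    ∃ r₁, Del M K v₁ r₁ ∧ Del M r₁ v₂ r := by
  induction v₁ generalizing K with
  | nil => exact ⟨K, .nil, h⟩
  | cons x v₁ ih =>
    cases h with
    | cons hx h =>
      obtain ⟨r₁, h₁, h₂⟩ := ih h
      exact ⟨r₁, .cons hx h₁, h₂⟩

/-- If all but a few elements of `J`, which fit into the `N - M` additional slots, form a
subsequence of `K`, then the greedy run from `J` with `N` slots writes everything in `J` that any
run from `K` with `M` slots writes, and the additional elements. -/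
theorem Greedy.sublist_of_del {M N : ℕ} {up : Bool} {J K w v r s : List α}
    (h : Greedy N up none J w r) (hd : Del M K v s) (hv : v.Pairwise (dle up))
    (hJ : J.Nodup) (hK : K.Nodup) (hJK : (J.filter (· ∈ K)).Sublist K)
    (hX : ∀ x ∈ J, x ∉ K → x ∈ J.take N) (hcard : (J.filter (· ∉ K)).length + M ≤ N) :
    r.Sublist s := by
  have hvn : ∀ z ∈ r, z ∈ K := fun z hz => by
    by_contra hzK
    exact h.notMem_take hJ hz (hX z (h.sublist.subset hz) hzK)
  -- No element of `v` is left behind: consider the first one that is.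
  have key : ∀ v₁ v₂, v = v₁ ++ v₂ → ∀ z ∈ r, z ∉ v₁ := by
    intro v₁
    induction v₁ using List.reverseRecOn with
    | nil => simp
    | append_singleton v₁ z ih =>
      intro v₂ hv₂ y hy hmem
      have hv₂' : v = v₁ ++ z :: v₂ := by simpa using hv₂
      have ih' := ih _ hv₂'
      obtain rfl : y = z := by simpa [ih' y hy] using hmem
      have h1 := hd.card_before_lt hK hv₂' (ih' y hy)
      set A : Finset α := v₁.toFinset.filter (· ∈ J) with hAdef
      have h2 := h.le_card_before hJ hy (fits_none up y) (A := A) fun x hx => by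
        obtain ⟨hx1, hxJ⟩ := Finset.mem_filter.1 hx
        rw [List.mem_toFinset] at hx1
        refine ⟨?_, ?_⟩
        · rcases List.mem_append.1 (h.perm.symm.subset hxJ) with hw | hr
          · exact hw
          · exact absurd hx1 (ih' x hr)
        · rw [hv₂', List.pairwise_append] at hv
          exact hv.2.2 x hx1 y (by simp)
      have hyJ := h.sublist.subset hy
      have hyK := hvn y hy
      have hsub : before J y \ A ⊆ (J.filter (· ∉ K)).toFinset ∪ (before K y \ v₁.toFinset) := by
        intro x hx
        obtain ⟨hxb, hxA⟩ := Finset.mem_sdiff.1 hx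
        have hxJ : x ∈ J := by
          simp only [before, List.mem_toFinset] at hxb
          exact (List.takeWhile_sublist _).subset hxb
        by_cases hxK : x ∈ K
        · refine Finset.mem_union_right _ (Finset.mem_sdiff.2 ⟨?_, fun hxv => hxA ?_⟩)
          · refine before_subset_of_sublist hJK hK (z := y) (by simp [hyJ, hyK]) ?_
            rw [before_filter hyK]
            exact Finset.mem_filter.2 ⟨hxb, hxK⟩
          · exact Finset.mem_filter.2 ⟨hxv, hxJ⟩
        · exact Finset.mem_union_left _ (by simp [hxJ, hxK])
      have h3 := (Finset.card_le_card hsub).trans (Finset.card_union_le _ _)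
      have h4 := List.toFinset_card_le (J.filter (· ∉ K))
      omega
  have hr : r = r.filter (fun x => x ∈ K ∧ x ∉ v) := by
    rw [eq_comm, List.filter_eq_self]
    intro z hz
    simpa using ⟨hvn z hz, key v [] (by simp) z hz⟩
  rw [hd.eq_filter hK, hr]
  refine (h.sublist.filter _).trans ?_
  have := hJK.filter (· ∉ v)
  rw [List.filter_filter] at this
  convert this using 2
  ext x
  simp [Bool.and_comm]

/-- With at least as many slots and no additional elements, greedy runs are best. -/
theorem Greedy.sublist_of_sublist {M N : ℕ} {up : Bool} {J K w v r s : List α}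
    (h : Greedy N up none J w r) (hd : Del M K v s) (hv : v.Pairwise (dle up))
    (hK : K.Nodup) (hJK : J.Sublist K) (hMN : M ≤ N) : r.Sublist s := by
  refine h.sublist_of_del hd hv (hK.sublist hJK) hK (List.filter_sublist.trans hJK)
    (fun x hx hxK => absurd (hJK.subset hx) hxK) ?_
  have : J.filter (· ∉ K) = [] := by
    rw [List.filter_eq_nil_iff]
    intro a ha
    simpa using hJK.subset ha
  rw [this]
  simpa using hMN

theorem Del.sublist {M : ℕ} {K v r : List α} (h : Del M K v r) : r.Sublist K := by
  induction h with
  | nil => simp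
  | cons _ _ ih => exact ih.trans List.erase_sublist

/-- A pair of runs in opposite directions is at least as good as any one run. -/
theorem sublist_of_two_runs {M N : ℕ} {c d : Bool} {J K v s w₁ r₁ w₂ r₂ : List α}
    (h₁ : Greedy M c none J w₁ r₁) (h₂ : Greedy N (!c) none r₁ w₂ r₂) (hMN : M ≤ N)
    (hd : Del M K v s) (hv : v.Pairwise (dle d)) (hK : K.Nodup) (hJK : J.Sublist K) :
    r₂.Sublist s := by
  by_cases hcd : d = c
  · subst hcd
    exact h₂.sublist.trans (h₁.sublist_of_sublist hd hv hK hJK le_rfl)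
  · obtain rfl : d = !c := by cases c <;> cases d <;> simp_all
    exact h₂.sublist_of_sublist hd hv hK (h₁.sublist.trans hJK) hMN

/-- If the greedy run in direction `c` consumes, up to `M` elements, at least as much of the input
as the one in direction `!c`, then three runs, the second of them with `2 * M` slots, are at least
as good as any two runs. -/
theorem sublist_of_three_runs {M : ℕ} {c d₁ d₂ : Bool}
    {J K v₁ K₁ v₂ K₂ w₁ r₁ w₂ r₂ w₃ r₃ wb rb : List α}
    (h₁ : Greedy M c none J w₁ r₁) (h₂ : Greedy (2 * M) (!c) none r₁ w₂ r₂)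
    (h₃ : Greedy M c none r₂ w₃ r₃) (hb : Greedy M (!c) none J wb rb) (hL : r₁.drop M ⊆ rb)
    (hd₁ : Del M K v₁ K₁) (hv₁ : v₁.Pairwise (dle d₁))
    (hd₂ : Del M K₁ v₂ K₂) (hv₂ : v₂.Pairwise (dle d₂)) (hK : K.Nodup) (hJK : J.Sublist K) :
    r₃.Sublist K₂ := by
  have hM : M ≤ 2 * M := by omega
  have hK₁ := hK.sublist hd₁.sublist
  have hr₁K := h₁.sublist.trans hJK
  have hr₂ : r₂.Sublist K₁ := sublist_of_two_runs h₁ h₂ hM hd₁ hv₁ hK hJK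
  by_cases hcd₂ : d₂ = c
  · subst hcd₂
    exact h₃.sublist_of_sublist hd₂ hv₂ hK₁ hr₂ le_rfl
  · obtain rfl : d₂ = !c := by cases c <;> cases d₂ <;> simp_all
    refine h₃.sublist.trans ?_
    by_cases hcd : d₁ = c
    · subst hcd
      exact h₂.sublist_of_sublist hd₂ hv₂ hK₁ (h₁.sublist_of_sublist hd₁ hv₁ hK hJK le_rfl) hM
    · -- The two runs to be matched both go in direction `!c`. What the first of them has written
      -- and the run in direction `c` has not is within the first `M` elements of `r₁`.
      obtain rfl : d₁ = !c := by cases c <;> cases d₁ <;> simp_all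
      have hrb := hb.sublist_of_sublist hd₁ hv₁ hK hJK le_rfl
      have hX : ∀ x ∈ r₁, x ∉ K₁ → x ∈ r₁.take M := fun x hx hxK => by
        rw [← List.take_append_drop M r₁, List.mem_append] at hx
        exact hx.resolve_right fun hx => hxK (hrb.subset (hL hx))
      refine h₂.sublist_of_del hd₂ hv₂ (hK.sublist hr₁K) hK₁ ?_
        (fun x hx hxK => (List.take_sublist_take_left hM).subset (hX x hx hxK)) ?_
      · have := hr₁K.filter (· ∈ K₁)
        refine this.trans ?_
        have hK₁' := hd₁.eq_filter hK
        rw [show K.filter (· ∈ K₁) = K₁ from ?_]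
        conv_rhs => rw [hK₁']
        refine List.filter_congr fun x hx => ?_
        rw [hK₁']
        simp [hx]
      · have hsp : (r₁.filter (· ∉ K₁)).Subperm (r₁.take M) :=
          List.subperm_of_subset ((hK.sublist hr₁K).filter _) fun x hx => by
            obtain ⟨hx1, hx2⟩ := List.mem_filter.1 hx
            exact hX x hx1 (by simpa using hx2)
        have := hsp.length_le
        have h' := List.length_take_le M r₁
        omega

/-! ### The number of runs and the optimum -/

theorem numRuns_le {parts : List (List α)} (h : ∀ p ∈ parts, IsRun p) :
    numRuns parts.flatten ≤ parts.length :=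
  Nat.sInf_le ⟨parts, rfl, rfl, h⟩

theorem exists_parts (S : List α) : ∃ parts : List (List α),
    parts.length = numRuns S ∧ parts.flatten = S ∧ ∀ p ∈ parts, IsRun p := by
  refine Nat.sInf_mem (s := {k | ∃ parts : List (List α),
    parts.length = k ∧ parts.flatten = S ∧ ∀ p ∈ parts, IsRun p})
    ⟨_, S.map (fun x => [x]), rfl, ?_, ?_⟩
  · induction S <;> simp_all
  · simp [IsRun]

@[simp] theorem numRuns_nil : numRuns ([] : List α) = 0 :=
  Nat.le_zero.1 (numRuns_le (parts := []) (by simp))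

theorem numRuns_append_le (S T : List α) : numRuns (S ++ T) ≤ numRuns S + numRuns T := by
  obtain ⟨P, hP, rfl, hP'⟩ := exists_parts S
  obtain ⟨Q, hQ, rfl, hQ'⟩ := exists_parts T
  rw [← hP, ← hQ, ← List.flatten_append, ← List.length_append]
  exact numRuns_le fun p hp => (List.mem_append.1 hp).elim (hP' p) (hQ' p)

theorem Greedy.numRuns_le_one {N : ℕ} {up : Bool} {o : Option α} {J w r : List α}
    (h : Greedy N up o J w r) : numRuns w ≤ 1 := by
  simpa using numRuns_le (parts := [w]) (by simpa using isRun_iff.2 ⟨up, h.pairwise⟩)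

theorem CanOutput.del {M : ℕ} {B : Multiset α} {I S : List α} (h : CanOutput M B I S)
    {L : List α} (hL : (L : Multiset α) = B) (hM : L.length ≤ M) : Del M (L ++ I) S [] := by
  induction h generalizing L with
  | done =>
    obtain rfl : L = [] := by simpa using hL
    exact .nil
  | @read B x I S hB _ ih =>
    subst hL
    have := @ih (L ++ [x]) (by rw [← Multiset.coe_add, add_comm]; rfl) (by simpa using hB)
    simpa using this
  | @write B x I S _ ih =>
    have hx : x ∈ L := by
      rw [← Multiset.mem_coe, hL]
      simp
    refine .cons ?_ ?_
    · rw [List.take_append, List.take_of_length_le hM]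
      simp [hx]
    · rw [List.erase_append_left _ hx]
      refine ih ?_ (List.length_erase_le.trans hM)
      rw [← Multiset.coe_erase, hL, Multiset.erase_cons_head]

theorem exists_canOutput {α : Type*} {M : ℕ} (hM : 1 ≤ M) (I : List α) : CanOutput M 0 I I := by
  induction I with
  | nil => exact .done
  | cons x I ih => exact .read (by rw [Multiset.card_zero]; omega) (.write ih)

/-- `K` can be written in `n` runs with an `M`-slot buffer. -/
def Solvable (M n : ℕ) (K : List α) : Prop :=
  ∃ parts : List (List α), parts.length = n ∧ (∀ p ∈ parts, IsRun p) ∧ Del M K parts.flatten []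

theorem solvable_opt {M : ℕ} (hM : 1 ≤ M) (I : List α) : Solvable M (opt M I) I := by
  obtain ⟨S, hS, hn⟩ : ∃ S : List α, CanOutput M 0 I S ∧ numRuns S = opt M I :=
    Nat.sInf_mem (s := {k | ∃ S : List α, CanOutput M 0 I S ∧ numRuns S = k})
      ⟨_, I, exists_canOutput hM I, rfl⟩
  obtain ⟨parts, hk, rfl, hruns⟩ := exists_parts S
  exact ⟨parts, hk.trans hn, hruns, by simpa using hS.del (L := []) rfl (by simp)⟩

theorem Solvable.eq_nil {M : ℕ} {K : List α} (h : Solvable M 0 K) : K = [] := by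
  obtain ⟨parts, hn, -, hd⟩ := h
  obtain rfl := List.length_eq_zero_iff.1 hn
  cases hd
  rfl

theorem Solvable.exists_run {M n : ℕ} {K : List α} (h : Solvable M (n + 1) K) :
    ∃ up v K₁, v.Pairwise (dle up) ∧ Del M K v K₁ ∧ Solvable M n K₁ := by
  obtain ⟨parts, hn, hr, hd⟩ := h
  cases parts with
  | nil => simp at hn
  | cons v parts =>
    obtain ⟨up, hup⟩ := isRun_iff.1 (hr v (by simp))
    obtain ⟨K₁, h₁, h₂⟩ := Del.split (by simpa using hd)
    exact ⟨up, v, K₁, hup, h₁, parts, by simpa using hn, fun p hp => hr p (by simp [hp]), h₂⟩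

end Combinatorics

/-! ### Executions of online algorithms -/

section Executions

variable {α : Type*} [LinearOrder α] {b : ℕ} (A : OnlineAlg α b)

/-- The law of the configuration reached from `c` in `t` steps. -/
noncomputable def lawFrom : ℕ → Config α A.State → PMF (Config α A.State)
  | 0, c => PMF.pure c
  | t + 1, c => (A.step c).bind (lawFrom t)

theorem lawFrom_succ' (t : ℕ) (c : Config α A.State) :
    lawFrom A (t + 1) c = (lawFrom A t c).bind A.step := by
  induction t generalizing c with
  | zero => simp [lawFrom]
  | succ t ih =>
    change (A.step c).bind (lawFrom A (t + 1)) = ((A.step c).bind (lawFrom A t)).bind A.step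
    rw [funext ih, PMF.bind_bind]

theorem law_eq_lawFrom (I : List α) (t : ℕ) :
    A.law I t = lawFrom A t ⟨I, [], [], A.start, false⟩ := by
  induction t with
  | zero => rfl
  | succ t ih => rw [lawFrom_succ', ← ih, OnlineAlg.law]

/-- Started in `c`, the algorithm always halts, with total output distributed according to `p`. -/
def HaltsWith (c : Config α A.State) (p : PMF (List α)) : Prop :=
  ∃ t : ℕ, (∀ c' ∈ (lawFrom A t c).support, c'.halted = true) ∧
    p = (lawFrom A t c).map Config.output

theorem lawFrom_add_of_halted {t : ℕ} {c : Config α A.State}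
    (h : ∀ c' ∈ (lawFrom A t c).support, c'.halted = true) (s : ℕ) :
    lawFrom A (t + s) c = lawFrom A t c := by
  induction s with
  | zero => rfl
  | succ s ih =>
    rw [← add_assoc, lawFrom_succ', ih]
    conv_rhs => rw [← PMF.bind_pure (lawFrom A t c)]
    ext x
    simp only [PMF.bind_apply]
    refine tsum_congr fun c' => ?_
    by_cases hc' : c' ∈ (lawFrom A t c).support
    · simp [OnlineAlg.step, h c' hc']
    · simp [(PMF.apply_eq_zero_iff _ _).2 hc']

variable {A}

theorem haltsWith_of_halted {c : Config α A.State} (h : c.halted = true) :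
    HaltsWith A c (PMF.pure c.output) :=
  ⟨0, by simpa [lawFrom] using h, by simp [lawFrom, PMF.pure_map]⟩

theorem HaltsWith.of_step {c c' : Config α A.State} {p : PMF (List α)}
    (hs : A.step c = PMF.pure c') (h : HaltsWith A c' p) : HaltsWith A c p := by
  obtain ⟨t, h1, h2⟩ := h
  exact ⟨t + 1, by simpa [lawFrom, hs] using h1, by simpa [lawFrom, hs] using h2⟩

theorem HaltsWith.of_coin {c : Config α A.State} {f : Bool → Config α A.State}
    {p : Bool → PMF (List α)} (hs : A.step c = (PMF.uniformOfFintype Bool).map f)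
    (h : ∀ i, HaltsWith A (f i) (p i)) :
    HaltsWith A c ((PMF.uniformOfFintype Bool).bind p) := by
  choose t h1 h2 using h
  have key : ∀ i, lawFrom A (t true + t false) (f i) = lawFrom A (t i) (f i) := by
    rintro (_ | _)
    · rw [add_comm]
      exact lawFrom_add_of_halted A (h1 _) _
    · exact lawFrom_add_of_halted A (h1 _) _
  have hlaw : lawFrom A (t true + t false + 1) c
      = (PMF.uniformOfFintype Bool).bind fun i => lawFrom A (t i) (f i) := by
    rw [lawFrom, hs, PMF.bind_map]
    congr 1
    exact funext key
  refine ⟨t true + t false + 1, ?_, ?_⟩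
  · rw [hlaw]
    intro c' hc'
    obtain ⟨i, -, hi⟩ := (PMF.mem_support_bind_iff _ _ _).1 hc'
    exact h1 i c' hi
  · rw [hlaw, PMF.map_bind]
    congr 1
    exact funext h2

variable (A) in
/-- `c'` is reached from `c` in some number of steps, none of which makes a random choice. -/
def Reach : Config α A.State → Config α A.State → Prop :=
  Relation.ReflTransGen fun c c' => A.step c = PMF.pure c'

theorem Reach.haltsWith {c c' : Config α A.State} {p : PMF (List α)} (h : Reach A c c')
    (hp : HaltsWith A c' p) : HaltsWith A c p := by
  induction h using Relation.ReflTransGen.head_induction_on with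
  | refl => exact hp
  | head hs _ ih => exact ih.of_step hs

theorem Reach.trans {c c' c'' : Config α A.State} (h : Reach A c c') (h' : Reach A c' c'') :
    Reach A c c'' :=
  Relation.ReflTransGen.trans h h'

end Executions

/-! ### The algorithm -/

/-- The place of a run within a block of consecutive runs. The first run of a block starts
alongside a simulation of the opposite run. If it ends strictly before the simulated run, and the
input has not been found to be exhausted, then the runs `four₂`, `four₃`, `last` follow. Otherwise
`three₁` stands for the rest of the first run, and the runs `three₂` and `last` follow. -/
inductive Phase
  | three₁ | three₂ | four₂ | four₃ | last
  deriving DecidableEq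

instance : Fintype Phase where
  elems := {.three₁, .three₂, .four₂, .four₃, .last}
  complete j := by cases j <;> decide

/-- The internal states of the algorithm. -/
inductive St
  /-- The start of a block: fill `M` slots and toss a coin. -/
  | fill
  /-- The start of a block when the input has been found to be exhausted. -/
  | drain
  /-- Writing the first run of a block, in direction `up`, alongside a simulation of the opposite
  run. The buffer holds the `M` elements that the real run has available, then the element that
  the simulated run writes next, then the other elements that the simulated run has available. -/
  | sim (up fresh : Bool)
  /-- The same, after the real run has written an element, which is now missing. -/
  | simRead (up : Bool)
  /-- The same, with a new element at the end of the buffer, which replaces both elements just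
  written. -/
  | simUpdate (up : Bool)
  /-- The same, when the input has been found to be exhausted. -/
  | simEnd (up : Bool)
  /-- Writing a greedy run without a simulation; `fresh` means that nothing of this run has been
  written, `eof` that the input is known to be exhausted. -/
  | run (up fresh eof : Bool) (j : Phase)
  deriving Fintype

section Algorithm

variable {α : Type*} [LinearOrder α]

/-- The number of slots that a run uses. -/
def window (M : ℕ) : Phase → ℕ
  | .three₂ => 2 * M
  | _ => M

/-- What follows the run in phase `j`. -/
def next (up eof : Bool) : Phase → St
  | .three₁ => .run (!up) true eof .three₂
  | .three₂ => .run (!up) true eof .last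
  | .four₂ => .run (!up) true eof .four₃
  | .four₃ => .run (!up) true eof .last
  | .last => .fill

/-- The last element of the current run, given the last element of the output. -/
def ref (fresh : Bool) (o : Option α) : Option α := if fresh then none else o

/-- The two copies of the elements of the buffer with which a simulation of the run in direction
`up` starts: the second copy begins with the first element of the simulated run. -/
noncomputable def simStart (up : Bool) (B : List α) : List α :=
  match pick up none B with
  | some d => B ++ d :: B.erase d
  | none => B

open Classical in
/-- The command that the algorithm with `2 * M` slots issues, as a function of the buffer, the last
element written and the state; at a coin toss, of the coin as well. -/
noncomputable def command (M : ℕ) (coin : Bool) (B : List α) (o : Option α) : St → Command α St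
  | .fill =>
    if B.length < M then .read .fill .drain
    else .rearrange (simStart (!coin) B) (.sim coin true)
  | .drain => if B = [] then .halt else .rearrange B (.run true true true .last)
  | .sim up fresh =>
    match pick up (ref fresh o) (B.take M) with
    | some x => .write x (.simRead up)
    | none => .rearrange (B.take M) (.run (!up) true false .four₂)
  | .simRead up => .read (.simUpdate up) (.simEnd up)
  | .simUpdate up =>
    match B.drop (M - 1) with
    | d :: E =>
      match pick (!up) (some d) E with
      | some d' =>
        .rearrange (B.take (M - 1) ++ B.drop (2 * M - 1) ++ d' :: E.erase d') (.sim up false)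
      | none => .rearrange (B.take (M - 1) ++ B.drop (2 * M - 1)) (.run up false false .three₁)
    | [] => .halt
  | .simEnd up => .rearrange (B.take (M - 1)) (.run up false true .three₁)
  | .run up fresh eof j =>
    if eof = false ∧ B.length < window M j then .read (.run up fresh false j) (.run up fresh true j)
    else
      match pick up (ref fresh o) (B.take (window M j)) with
      | some x => .write x (.run up false eof j)
      | none => .rearrange B (next up eof j)

variable (α) in
/-- The algorithm with `2 * M` slots. -/
noncomputable def upDown (M : ℕ) : OnlineAlg α (2 * M) where
  State := St
  start := .fill
  act B o s := (PMF.uniformOfFintype Bool).map fun coin => command M coin B o s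

variable {M : ℕ}

theorem step_upDown (Inp B O : List α) (s : St) :
    (upDown α M).step ⟨Inp, B, O, s, false⟩ = (PMF.uniformOfFintype Bool).map fun coin =>
      exec (2 * M) ⟨Inp, B, O, s, false⟩ (command M coin B O.getLast? s) := by
  simp only [OnlineAlg.step, upDown, PMF.map_comp]
  rfl

/-- `c'` is reached from `c` by the algorithm with certainty. -/
def Runs (M : ℕ) (c c' : Config α St) : Prop := Reach (upDown α M) c c'

theorem Runs.trans {c c' c'' : Config α St} (h : Runs M c c') (h' : Runs M c' c'') :
    Runs M c c'' :=
  Reach.trans h h'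

theorem runs_step {Inp B O : List α} {s : St} {c : Config α St}
    (h : ∀ coin, exec (2 * M) ⟨Inp, B, O, s, false⟩ (command M coin B O.getLast? s) = c) :
    Runs M ⟨Inp, B, O, s, false⟩ c := by
  refine Relation.ReflTransGen.single ?_
  exact (step_upDown Inp B O s).trans (by rw [funext h]; exact PMF.map_const _ _)

end Algorithm

section Correctness

variable {α : Type*} [LinearOrder α] {M : ℕ}

theorem window_le (M : ℕ) (j : Phase) : window M j ≤ 2 * M := by
  cases j <;> simp only [window] <;> omega

theorem le_window (M : ℕ) (j : Phase) : M ≤ window M j := by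
  cases j <;> simp only [window] <;> omega

/-! ### The executions of single runs -/

/-- Before each write, a run fills its window. -/
theorem reach_fill_window (up fresh : Bool) (j : Phase) (O : List α) (eof : Bool)
    (B Inp : List α) (he : eof = true → Inp = []) : ∃ B' Inp' eof',
      Runs M ⟨Inp, B, O, .run up fresh eof j, false⟩
        ⟨Inp', B', O, .run up fresh eof' j, false⟩ ∧
      B' ++ Inp' = B ++ Inp ∧ (eof' = true → Inp' = []) ∧
      (eof' = false → window M j ≤ B'.length) ∧ B'.length ≤ max (window M j) B.length := by
  by_cases hr : eof = false ∧ B.length < window M j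
  · have hlt : B.length < 2 * M := hr.2.trans_le (window_le M j)
    obtain rfl := hr.1
    induction Inp generalizing B with
    | nil =>
      refine ⟨B, [], true, runs_step fun coin => ?_, rfl, fun _ => rfl, by simp, by simp⟩
      simp [command, hr.2, exec, hlt]
    | cons x Inp ih =>
      have hs : Runs M ⟨x :: Inp, B, O, .run up fresh false j, false⟩
          ⟨Inp, B ++ [x], O, .run up fresh false j, false⟩ := runs_step fun coin => by
        simp [command, hr.2, exec, hlt]
      by_cases hB : (B ++ [x]).length < window M j
      · obtain ⟨B', Inp', eof', h1, h2, h3, h4, h5⟩ :=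
          ih (B ++ [x]) (hB.trans_le (window_le M j)) (by simp) ⟨rfl, hB⟩
        refine ⟨B', Inp', eof', hs.trans h1, by simpa using h2, h3, h4, h5.trans ?_⟩
        rw [max_eq_left hB.le]
        exact le_max_left _ _
      · refine ⟨_, _, false, hs, by simp, by simp, fun _ => not_lt.1 hB, ?_⟩
        rw [List.length_append, List.length_singleton]
        exact (Nat.succ_le_of_lt hr.2).trans (le_max_left _ _)
  · refine ⟨B, Inp, eof, Relation.ReflTransGen.refl, rfl, he, fun h => ?_, le_max_right _ _⟩
    exact not_lt.1 fun hlt => hr ⟨h, hlt⟩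

/-- In the states `St.run`, the algorithm performs a greedy run. -/
theorem reach_run {up : Bool} {j : Phase} {o : Option α} {J w r : List α}
    (h : Greedy (window M j) up o J w r) :
    ∀ (B Inp O : List α) (fresh eof : Bool), B ++ Inp = J → ref fresh O.getLast? = o →
      B.length ≤ 2 * M → (eof = true → Inp = []) → ∃ B' Inp' eof',
        Runs M ⟨Inp, B, O, .run up fresh eof j, false⟩
          ⟨Inp', B', O ++ w, next up eof' j, false⟩ ∧
        B' ++ Inp' = r ∧ (eof' = true → Inp' = []) ∧
        B'.length ≤ max (window M j) (B.length - w.length) := by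
  have hW := window_le M j
  induction h with
  | @finished o J h =>
    rintro B Inp O fresh eof rfl rfl hB he
    obtain ⟨B', Inp', eof', h1, h2, h3, h4, h5⟩ :=
      reach_fill_window (M := M) up fresh j O eof B Inp he
    refine ⟨B', Inp', eof', h1.trans (runs_step fun coin => ?_), h2, h3, by simpa using h5⟩
    have hp : pick up (ref fresh O.getLast?) (B'.take (window M j)) = none := by
      refine pick_eq_none fun x hx => h x ?_
      rw [← h2, List.take_append]
      exact List.mem_append_left _ hx
    have hlen : B'.length ≤ 2 * M := h5.trans (max_le hW hB)
    have hr : ¬ (eof' = false ∧ B'.length < window M j) := fun hr => (h4 hr.1).not_gt hr.2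
    simp only [command, if_neg hr, hp]
    simp [exec, hlen]
  | @step o J w r x hx h ih =>
    rintro B Inp O fresh eof rfl rfl hB he
    obtain ⟨B', Inp', eof', h1, h2, h3, h4, h5⟩ :=
      reach_fill_window (M := M) up fresh j O eof B Inp he
    have htake : (B ++ Inp).take (window M j) = B'.take (window M j) := by
      rw [← h2]
      cases eof' with
      | true => simp [h3 rfl]
      | false => rw [List.take_append_of_le_length (h4 rfl)]
    rw [htake] at hx
    have hxB : x ∈ B' := List.mem_of_mem_take hx.1
    have hr : ¬ (eof' = false ∧ B'.length < window M j) := fun hr => (h4 hr.1).not_gt hr.2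
    have hlen := List.length_erase_of_mem hxB
    obtain ⟨B'', Inp'', eof'', g1, g2, g3, g4⟩ := ih (B'.erase x) Inp' (O ++ [x]) false eof'
      (by rw [← h2, List.erase_append_left _ hxB]) (by simp [ref])
      (List.length_erase_le.trans (h5.trans (max_le hW hB))) h3
    rw [← List.append_cons] at g1
    refine ⟨B'', Inp'', eof'', h1.trans (.trans (runs_step fun coin => ?_) g1), g2, g3,
      g4.trans ?_⟩
    · simp only [command, if_neg hr, pick_eq_some hx]
      simp [exec, hxB]
    · rw [hlen, List.length_cons]
      omega

/-- A run from scratch. It leaves no more elements in the buffer than its window holds. -/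
theorem reach_fresh_run {up : Bool} {j : Phase} {J w r : List α}
    (h : Greedy (window M j) up none J w r) (hJ : J.Nodup)
    {B Inp : List α} (O : List α) {eof : Bool} (hBI : B ++ Inp = J) (hB : B.length ≤ 2 * M)
    (he : eof = true → Inp = []) : ∃ B' Inp' eof',
        Runs M ⟨Inp, B, O, .run up true eof j, false⟩
          ⟨Inp', B', O ++ w, next up eof' j, false⟩ ∧
        B' ++ Inp' = r ∧ (eof' = true → Inp' = []) ∧ B'.length ≤ window M j := by
  obtain ⟨B', Inp', eof', h1, h2, h3, h4⟩ := reach_run h B Inp O true eof hBI (by simp [ref]) hB he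
  refine ⟨B', Inp', eof', h1, h2, h3, h4.trans ?_⟩
  have := h.le_length hJ
  have := le_window M j
  have hlen : J.length = B.length + Inp.length := by rw [← hBI, List.length_append]
  omega

/-- A first run of a block together with the simulation of the opposite one, which is to leave
`rb`: either the real run ends strictly before the simulated one, or all that it leaves behind
the first `M` elements is left by the simulated run as well. -/
theorem reach_sim (hM : 1 ≤ M) {up : Bool} {o : Option α} {J w r : List α}
    (h : Greedy M up o J w r) :
    ∀ (U E Inp O : List α) (d : α) (fresh : Bool) (wb rb : List α), U ++ Inp = J →
      ref fresh O.getLast? = o → U.length = M → E.length + 1 = M →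
      Greedy M (!up) (some d) (E ++ Inp) wb rb → ∃ B' Inp',
        B' ++ Inp' = r ∧ B'.length ≤ M ∧
        ((∃ eof, (eof = true → Inp' = []) ∧ r.drop M ⊆ rb ∧
          Runs M ⟨Inp, U ++ d :: E, O, .sim up fresh, false⟩
            ⟨Inp', B', O ++ w, .run (!up) true eof .three₂, false⟩) ∨
        (rb.length < r.length ∧
          Runs M ⟨Inp, U ++ d :: E, O, .sim up fresh, false⟩
            ⟨Inp', B', O ++ w, .run (!up) true false .four₂, false⟩)) := by
  induction h with
  | @finished o J h =>
    rintro U E Inp O d fresh wb rb rfl rfl hU hE hb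
    refine ⟨U, Inp, rfl, hU.le, .inr ⟨?_, runs_step fun coin => ?_⟩⟩
    · have := hb.sublist.length_le
      simp only [List.length_append] at this ⊢
      omega
    · have htake : (U ++ d :: E).take M = U := by simp [← hU]
      have hp : pick up (ref fresh O.getLast?) U = none :=
        pick_eq_none fun x hx => h x (by simpa [← hU] using hx)
      simp only [command, htake, hp]
      simp only [exec]
      rw [if_pos ⟨fun x hx => by simp [hx], by omega⟩]
      simp
  | @step o J w r x hx h ih =>
    rintro U E Inp O d fresh wb rb rfl rfl hU hE hb
    have htake : (U ++ d :: E).take M = U := by simp [← hU]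
    rw [List.take_append_of_le_length hU.ge, List.take_of_length_le hU.le] at hx
    have hxU := hx.1
    have hlen := List.length_erase_of_mem hxU
    have hlen' : (U.erase x).length = M - 1 := by rw [hlen, hU]
    have hs : Runs M ⟨Inp, U ++ d :: E, O, .sim up fresh, false⟩
        ⟨Inp, U.erase x ++ d :: E, O ++ [x], .simRead up, false⟩ := runs_step fun coin => by
      simp only [command, htake, pick_eq_some hx]
      simp [exec, hxU, List.erase_append_left]
    have hlt : (U.erase x).length + (E.length + 1) < 2 * M := by omega
    rw [List.erase_append_left _ hxU] at h ih
    -- the steps after the simulation has ended or the input is exhausted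
    have main : ∀ (B Inp' : List α) (eof : Bool), B ++ Inp' = U.erase x ++ Inp → B.length ≤ M →
        (eof = true → Inp' = []) → (r.drop M ⊆ rb) →
        Runs M ⟨Inp, U.erase x ++ d :: E, O ++ [x], .simRead up, false⟩
          ⟨Inp', B, O ++ [x], .run up false eof .three₁, false⟩ → ∃ B' Inp',
        B' ++ Inp' = r ∧ B'.length ≤ M ∧
        ((∃ eof, (eof = true → Inp' = []) ∧ r.drop M ⊆ rb ∧
          Runs M ⟨Inp, U ++ d :: E, O, .sim up fresh, false⟩
            ⟨Inp', B', O ++ x :: w, .run (!up) true eof .three₂, false⟩) ∨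
        (rb.length < r.length ∧
          Runs M ⟨Inp, U ++ d :: E, O, .sim up fresh, false⟩
            ⟨Inp', B', O ++ x :: w, .run (!up) true false .four₂, false⟩)) := by
      intro B Inp' eof hBI hB he hr hreach
      obtain ⟨B', Inp'', eof', g1, g2, g3, g4⟩ := reach_run (M := M) (j := .three₁) h B Inp'
        (O ++ [x]) false eof hBI (by simp [ref]) (by omega) he
      refine ⟨B', Inp'', g2, g4.trans (max_le le_rfl ?_), .inl ⟨eof', g3, hr, ?_⟩⟩
      · omega
      · rw [List.append_cons O]
        exact hs.trans (hreach.trans g1)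
    cases Inp with
    | nil =>
      refine main (U.erase x) [] true rfl (by omega) (fun _ => rfl) ?_ ?_
      · have := h.sublist.length_le
        rw [List.drop_eq_nil_of_le]
        · simp
        · refine this.trans ?_
          simp [hlen']
      · refine .trans (c' := ⟨[], U.erase x ++ d :: E, O ++ [x], .simEnd up, false⟩)
          (runs_step fun coin => ?_) (runs_step fun coin => ?_)
        · simp [command, exec, hlt]
        · have : (U.erase x ++ d :: E).take (M - 1) = U.erase x := by simp [← hlen']
          simp only [command, this]
          simp only [exec]
          rw [if_pos]
          exact ⟨fun y hy => by simp [hy], by omega⟩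
    | cons y Inp =>
      have hs₂ : Runs M ⟨y :: Inp, U.erase x ++ d :: E, O ++ [x], .simRead up, false⟩
          ⟨Inp, U.erase x ++ d :: (E ++ [y]), O ++ [x], .simUpdate up, false⟩ :=
        runs_step fun coin => by simp [command, exec, hlt]
      have ht : (U.erase x ++ d :: (E ++ [y])).take (M - 1) = U.erase x := by simp [← hlen']
      have hd : (U.erase x ++ d :: (E ++ [y])).drop (M - 1) = d :: (E ++ [y]) := by simp [← hlen']
      have hl : (U.erase x ++ d :: (E ++ [y])).drop (2 * M - 1) = [y] := by
        rw [show U.erase x ++ d :: (E ++ [y]) = (U.erase x ++ d :: E) ++ [y] by simp]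
        refine List.drop_left' ?_
        simp only [List.length_append, List.length_cons]
        omega
      have hE' : (E ++ [y]).take M = E ++ [y] := List.take_of_length_le (by simp [hE])
      have htE : (E ++ y :: Inp).take M = E ++ [y] := by
        rw [List.append_cons, List.take_append_of_le_length (by simp [hE]), hE']
      cases hb with
      | finished hb =>
        refine main (U.erase x ++ [y]) Inp false (by simp) (by simp; omega) (by simp) ?_
          (hs₂.trans (runs_step fun coin => ?_))
        · have h1 := (h.sublist.drop M).subset
          have h2 : (U.erase x ++ y :: Inp).drop M = Inp := by
            rw [List.append_cons]
            exact List.drop_left' (by simp; omega)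
          rw [h2] at h1
          exact fun z hz => by simp [h1 hz]
        · rw [htE] at hb
          simp only [command, hd, pick_eq_none hb, ht, hl]
          simp only [exec]
          rw [if_pos]
          exact ⟨fun z hz => by simp at hz ⊢; tauto, by simp; omega⟩
      | @step _ _ wb _ d' hd' hb =>
        rw [htE] at hd'
        have hlE := List.length_erase_of_mem hd'.1
        rw [List.append_cons, List.erase_append_left _ hd'.1] at hb
        obtain ⟨B', Inp', g1, g2, g3⟩ := ih (U.erase x ++ [y]) ((E ++ [y]).erase d') Inp
          (O ++ [x]) d' false wb rb (by simp) (by simp [ref]) (by simp; omega)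
          (by rw [hlE]; simp; omega) hb
        have hs₃ : Runs M
            ⟨Inp, U.erase x ++ d :: (E ++ [y]), O ++ [x], .simUpdate up, false⟩
            ⟨Inp, U.erase x ++ [y] ++ d' :: (E ++ [y]).erase d', O ++ [x], .sim up false, false⟩ :=
          runs_step fun coin => by
            simp only [command, hd, pick_eq_some hd', ht, hl]
            simp only [exec]
            rw [if_pos]
            refine ⟨fun z hz => ?_, ?_⟩
            · have h1 : z ∈ (E ++ [y]).erase d' → z ∈ E ++ [y] := List.mem_of_mem_erase
              have h2 := hd'.1
              simp only [List.mem_append, List.mem_cons] at hz h1 h2 ⊢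
              rcases hz with (hz | rfl | hz) | rfl | hz <;> simp_all
            · simp only [List.length_append, List.length_cons, hlE, List.length_nil]
              omega
        refine ⟨B', Inp', g1, g2, ?_⟩
        have hall := hs.trans (hs₂.trans hs₃)
        rw [List.append_cons O]
        rcases g3 with ⟨eof, e1, e2, e3⟩ | ⟨e1, e2⟩
        · exact .inl ⟨eof, e1, e2, hall.trans e3⟩
        · exact .inr ⟨e1, hall.trans e2⟩

end Correctness

section Expectation

variable {α : Type*} [LinearOrder α]

/-! ### Expected numbers of runs -/

/-- The expected number of runs of a random sequence. -/
noncomputable def expRuns (p : PMF (List α)) : ℝ≥0∞ := ∑' S : List α, p S * (numRuns S : ℝ≥0∞)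

theorem expRuns_pure (S : List α) : expRuns (PMF.pure S) = numRuns S := by
  rw [expRuns, tsum_eq_single S]
  · simp
  · intro T hT
    simp [hT]

theorem expRuns_bind {ι : Type*} (p : PMF ι) (q : ι → PMF (List α)) :
    expRuns (p.bind q) = ∑' i, p i * expRuns (q i) := by
  simp only [expRuns, PMF.bind_apply, ← ENNReal.tsum_mul_right, ← ENNReal.tsum_mul_left]
  rw [ENNReal.tsum_comm]
  simp only [mul_assoc]

theorem expRuns_coin (q : Bool → PMF (List α)) :
    expRuns ((PMF.uniformOfFintype Bool).bind q)
      = 2⁻¹ * (expRuns (q true) + expRuns (q false)) := by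
  rw [expRuns_bind, tsum_bool]
  simp [mul_add, add_comm]

theorem expRuns_append_le (w : List α) (q : PMF (List α)) :
    expRuns (q.map (w ++ ·)) ≤ numRuns w + expRuns q := by
  rw [← PMF.bind_pure_comp, expRuns_bind]
  calc ∑' S, q S * expRuns (PMF.pure (w ++ S))
      ≤ ∑' S, (q S * numRuns w + q S * numRuns S) := by
        refine ENNReal.tsum_le_tsum fun S => ?_
        rw [← mul_add, expRuns_pure]
        gcongr
        exact_mod_cast numRuns_append_le w S
    _ = numRuns w + expRuns q := by
        rw [ENNReal.tsum_add, ENNReal.tsum_mul_right, q.tsum_coe, one_mul, expRuns]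

end Expectation

section Blocks

variable {α : Type*} [LinearOrder α] {M : ℕ}

/-! ### Blocks of runs -/

theorem numRuns_append_le_add {S T : List α} {a b : ℕ} (hS : numRuns S ≤ a) (hT : numRuns T ≤ b) :
    numRuns (S ++ T) ≤ a + b :=
  (numRuns_append_le S T).trans (add_le_add hS hT)

theorem Greedy.eq_nil {N : ℕ} {up : Bool} {o : Option α} {w r : List α}
    (h : Greedy N up o [] w r) : w = [] ∧ r = [] := by
  simpa using h.perm

/-- The execution of a block of runs. Either it consists of three runs, or the simulated run lasts
longer than the first run, and it consists of four runs. -/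
theorem runs_block (hM : 1 ≤ M) (up : Bool) {B Inp J : List α} (O : List α)
    (hBI : B ++ Inp = J) (hB : B.length = M) (hJ : J.Nodup) {w₁ r₁ wb rb : List α}
    (h₁ : Greedy M up none J w₁ r₁) (hb : Greedy M (!up) none J wb rb) :
    ∃ w B' Inp', Runs M ⟨Inp, simStart (!up) B, O, .sim up true, false⟩
        ⟨Inp', B', O ++ (w₁ ++ w), .fill, false⟩ ∧ B'.length ≤ M ∧
      ((r₁.drop M ⊆ rb ∧ ∃ w₂ w₃ r₂, Greedy (2 * M) (!up) none r₁ w₂ r₂ ∧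
        Greedy M up none r₂ w₃ (B' ++ Inp') ∧ w = w₂ ++ w₃) ∨
      (rb.length < r₁.length ∧ ∃ w₂ w₃ w₄ r₂ r₃, Greedy M (!up) none r₁ w₂ r₂ ∧
        Greedy M up none r₂ w₃ r₃ ∧ Greedy M (!up) none r₃ w₄ (B' ++ Inp') ∧
        w = w₂ ++ (w₃ ++ w₄))) := by
  have hr₁ := hJ.sublist h₁.sublist
  have hM2 : M ≤ 2 * M := by omega
  have htake : J.take M = B := by
    rw [← hBI, List.take_append_of_le_length hB.ge, List.take_of_length_le hB.le]
  cases hb with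
  | finished hb =>
    rw [htake] at hb
    cases B with
    | nil => simp at hB; omega
    | cons x B => exact absurd (fits_none _ x) (hb x (by simp))
  | @step _ _ wb _ d hd hb =>
    rw [htake] at hd
    have hlen := List.length_erase_of_mem hd.1
    rw [← hBI, List.erase_append_left _ hd.1] at hb
    have hstart : simStart (!up) B = B ++ d :: B.erase d := by simp [simStart, pick_eq_some hd]
    rw [hstart]
    obtain ⟨B₁, Inp₁, rfl, hB₁, ⟨eof, he, hL, hR⟩ | ⟨hS, hR⟩⟩ :=
      reach_sim hM h₁ B (B.erase d) Inp O d true wb rb hBI (by simp [ref]) hB (by omega) hb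
    · obtain ⟨w₂, r₂, h₂⟩ := exists_greedy (2 * M) (!up) none (B₁ ++ Inp₁)
      obtain ⟨w₃, r₃, h₃⟩ := exists_greedy M up none r₂
      have hr₂ := hr₁.sublist h₂.sublist
      obtain ⟨B₂, Inp₂, eof₂, g₁, rfl, g₃, g₄⟩ := reach_fresh_run (M := M) (j := .three₂) h₂ hr₁
        (O ++ w₁) rfl (hB₁.trans hM2) he
      obtain ⟨B₃, Inp₃, eof₃, f₁, rfl, f₃, f₄⟩ := reach_fresh_run (M := M) (j := .last) h₃ hr₂
        (O ++ w₁ ++ w₂) rfl g₄ g₃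
      rw [next, Bool.not_not] at g₁
      rw [next] at f₁
      refine ⟨w₂ ++ w₃, B₃, Inp₃, ?_, f₄, .inl ⟨hL, w₂, w₃, _, h₂, h₃, rfl⟩⟩
      simpa using hR.trans (g₁.trans f₁)
    · obtain ⟨w₂, r₂, h₂⟩ := exists_greedy M (!up) none (B₁ ++ Inp₁)
      obtain ⟨w₃, r₃, h₃⟩ := exists_greedy M up none r₂
      obtain ⟨w₄, r₄, h₄⟩ := exists_greedy M (!up) none r₃
      have hr₂ := hr₁.sublist h₂.sublist
      have hr₃ := hr₂.sublist h₃.sublist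
      obtain ⟨B₂, Inp₂, eof₂, g₁, rfl, g₃, g₄⟩ := reach_fresh_run (M := M) (j := .four₂) h₂ hr₁
        (O ++ w₁) (eof := false) rfl (hB₁.trans hM2) (by simp)
      obtain ⟨B₃, Inp₃, eof₃, f₁, rfl, f₃, f₄⟩ := reach_fresh_run (M := M) (j := .four₃) h₃ hr₂
        (O ++ w₁ ++ w₂) rfl (g₄.trans hM2) g₃
      obtain ⟨B₄, Inp₄, eof₄, e₁, rfl, e₃, e₄⟩ := reach_fresh_run (M := M) (j := .last) h₄ hr₃
        (O ++ w₁ ++ w₂ ++ w₃) rfl (f₄.trans hM2) f₃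
      rw [next, Bool.not_not] at g₁
      rw [next] at e₁
      refine ⟨w₂ ++ (w₃ ++ w₄), B₄, Inp₄, ?_, e₄, .inr ⟨hS, w₂, w₃, w₄, _, _, h₂, h₃, h₄, rfl⟩⟩
      simpa using hR.trans (g₁.trans (f₁.trans e₁))

/-- The progress made by a block. If what is left is part of a sequence `K` that takes an `M`-slot
buffer `n + 1` runs, the block reduces this by two runs (to zero if there are fewer), and itself
writes at most four runs, or three if the first of them is at least as long as the opposite one. -/
theorem exists_block (hM : 1 ≤ M) (up : Bool) {B Inp J K : List α} (O : List α) {n : ℕ}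
    (hBI : B ++ Inp = J) (hB : B.length = M) (hJK : J.Sublist K) (hK : K.Nodup)
    (hs : Solvable M (n + 1) K) {w₁ r₁ wb rb : List α} (h₁ : Greedy M up none J w₁ r₁)
    (hb : Greedy M (!up) none J wb rb) :
    ∃ w B' Inp' K', Runs M ⟨Inp, simStart (!up) B, O, .sim up true, false⟩
        ⟨Inp', B', O ++ w, .fill, false⟩ ∧
      (w ++ (B' ++ Inp')).Perm J ∧ B'.length ≤ M ∧ (B' ++ Inp').Sublist K' ∧ K'.Nodup ∧
      Solvable M (n - 1) K' ∧
      (n = 0 → numRuns w ≤ 2 ∧ (r₁ = [] → numRuns w ≤ 1)) ∧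
      numRuns w ≤ 4 ∧ (r₁.length ≤ rb.length → numRuns w ≤ 3) := by
  have hM2 : M ≤ 2 * M := by omega
  obtain ⟨w, B', Inp', hR, hB', hcases⟩ := runs_block hM up O hBI hB (hK.sublist hJK) h₁ hb
  obtain ⟨d₁, v₁, K₁, hv₁, hd₁, hs₁⟩ := hs.exists_run
  have hK₁ := hK.sublist hd₁.sublist
  have hperm : (w ++ (B' ++ Inp')).Perm r₁ := by
    rcases hcases with ⟨-, w₂, w₃, r₂, h₂, h₃, rfl⟩ | ⟨-, w₂, w₃, w₄, r₂, r₃, h₂, h₃, h₄, rfl⟩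
    · rw [List.append_assoc]
      exact (h₃.perm.append_left _).trans h₂.perm
    · rw [List.append_assoc, List.append_assoc]
      exact ((h₄.perm.append_left _).trans h₃.perm |>.append_left _).trans h₂.perm
  have hfour : numRuns (w₁ ++ w) ≤ 4 ∧ (r₁.length ≤ rb.length → numRuns (w₁ ++ w) ≤ 3) := by
    rcases hcases with ⟨-, w₂, w₃, r₂, h₂, h₃, rfl⟩ | ⟨hlt, w₂, w₃, w₄, r₂, r₃, h₂, h₃, h₄, rfl⟩
    · have := numRuns_append_le_add h₁.numRuns_le_one
        (numRuns_append_le_add h₂.numRuns_le_one h₃.numRuns_le_one)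
      exact ⟨by omega, fun _ => by omega⟩
    · have := numRuns_append_le_add h₁.numRuns_le_one (numRuns_append_le_add h₂.numRuns_le_one
        (numRuns_append_le_add h₃.numRuns_le_one h₄.numRuns_le_one))
      exact ⟨by omega, fun _ => by omega⟩
  have hone : r₁ = [] → numRuns (w₁ ++ w) ≤ 1 := by
    rintro rfl
    obtain ⟨rfl, -⟩ : w = [] ∧ _ := by simpa using hperm
    simpa using h₁.numRuns_le_one
  have hpermJ : (w₁ ++ w ++ (B' ++ Inp')).Perm J := by
    rw [List.append_assoc]
    exact (hperm.append_left _).trans h₁.perm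
  cases n with
  | zero =>
    obtain rfl := hs₁.eq_nil
    obtain ⟨hnil, htwo⟩ : B' ++ Inp' = [] ∧ numRuns (w₁ ++ w) ≤ 2 := by
      rcases hcases with ⟨-, w₂, w₃, r₂, h₂, h₃, rfl⟩ | ⟨-, w₂, w₃, w₄, r₂, r₃, h₂, h₃, h₄, rfl⟩
      · obtain rfl := List.sublist_nil.1 (sublist_of_two_runs h₁ h₂ hM2 hd₁ hv₁ hK hJK)
        obtain ⟨rfl, hnil⟩ := h₃.eq_nil
        exact ⟨hnil, by simpa using numRuns_append_le_add h₁.numRuns_le_one h₂.numRuns_le_one⟩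
      · obtain rfl := List.sublist_nil.1 (sublist_of_two_runs h₁ h₂ le_rfl hd₁ hv₁ hK hJK)
        obtain ⟨rfl, rfl⟩ := h₃.eq_nil
        obtain ⟨rfl, hnil⟩ := h₄.eq_nil
        exact ⟨hnil, by simpa using numRuns_append_le_add h₁.numRuns_le_one h₂.numRuns_le_one⟩
    exact ⟨w₁ ++ w, B', Inp', [], hR, hpermJ, hB', by rw [hnil], List.nodup_nil, hs₁,
      fun _ => ⟨htwo, hone⟩, hfour⟩
  | succ n =>
    obtain ⟨d₂, v₂, K₂, hv₂, hd₂, hs₂⟩ := hs₁.exists_run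
    refine ⟨w₁ ++ w, B', Inp', K₂, hR, hpermJ, hB', ?_, hK₁.sublist hd₂.sublist, hs₂, by simp,
      hfour⟩
    rcases hcases with ⟨hL, w₂, w₃, r₂, h₂, h₃, rfl⟩ | ⟨-, w₂, w₃, w₄, r₂, r₃, h₂, h₃, h₄, rfl⟩
    · exact sublist_of_three_runs h₁ h₂ h₃ hb hL hd₁ hv₁ hd₂ hv₂ hK hJK
    · exact sublist_of_two_runs h₃ h₄ le_rfl hd₂ hv₂ hK₁
        (sublist_of_two_runs h₁ h₂ le_rfl hd₁ hv₁ hK hJK)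

/-- Filling the buffer at the start of a block. -/
theorem runs_fill (O : List α) (B Inp : List α) (hB : B.length ≤ M) :
    (∃ B' Inp', Runs M ⟨Inp, B, O, .fill, false⟩ ⟨Inp', B', O, .fill, false⟩ ∧
      B' ++ Inp' = B ++ Inp ∧ B'.length = M) ∨
    ((B ++ Inp).length < M ∧
      Runs M ⟨Inp, B, O, .fill, false⟩ ⟨[], B ++ Inp, O, .drain, false⟩) := by
  induction Inp generalizing B with
  | nil =>
    rcases hB.eq_or_lt with hB | hB
    · exact .inl ⟨B, [], Relation.ReflTransGen.refl, rfl, hB⟩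
    · refine .inr ⟨by simpa using hB, runs_step fun coin => ?_⟩
      have : B.length < 2 * M := by omega
      simp [command, exec, hB, this]
  | cons x Inp ih =>
    rcases hB.eq_or_lt with hB | hB
    · exact .inl ⟨B, _, Relation.ReflTransGen.refl, rfl, hB⟩
    · have hs : Runs M ⟨x :: Inp, B, O, .fill, false⟩ ⟨Inp, B ++ [x], O, .fill, false⟩ :=
        runs_step fun coin => by
          have : B.length < 2 * M := by omega
          simp [command, exec, hB, this]
      rcases ih (B ++ [x]) (by simpa using hB) with ⟨B', Inp', h1, h2, h3⟩ | ⟨h1, h2⟩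
      · exact .inl ⟨B', Inp', hs.trans h1, by simpa using h2, h3⟩
      · exact .inr ⟨by simpa using h1, by simpa using hs.trans h2⟩

theorem haltsWith_drain_nil (O : List α) :
    HaltsWith (upDown α M) ⟨[], [], O, St.drain, false⟩ (PMF.pure O) := by
  have : Runs M ⟨[], [], O, .drain, false⟩ ⟨[], [], O, .drain, true⟩ :=
    runs_step fun coin => by simp [command, exec]
  exact Reach.haltsWith this (haltsWith_of_halted rfl)

theorem haltsWith_fill_nil (hM : 1 ≤ M) (O : List α) :
    HaltsWith (upDown α M) ⟨[], [], O, St.fill, false⟩ (PMF.pure O) := by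
  rcases runs_fill (M := M) O [] [] (by simp) with ⟨B', Inp', -, h2, h3⟩ | ⟨-, h⟩
  · obtain ⟨rfl, -⟩ : B' = [] ∧ _ := by simpa using h2
    simp at h3
    omega
  · exact Reach.haltsWith h (haltsWith_drain_nil O)

/-- When fewer than `M` elements are left, one run writes them. -/
theorem haltsWith_drain (hM : 1 ≤ M) {B : List α} (O : List α) (hB : B.length < M) (hn : B.Nodup) :
    ∃ w, w.Perm B ∧ numRuns w ≤ 1 ∧
      HaltsWith (upDown α M) ⟨[], B, O, St.drain, false⟩ (PMF.pure (O ++ w)) := by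
  by_cases hB0 : B = []
  · subst hB0
    exact ⟨[], .nil, by simp, by simpa using haltsWith_drain_nil O⟩
  · obtain ⟨w, r, h⟩ := exists_greedy M true none B
    obtain rfl : r = [] := List.eq_nil_iff_forall_not_mem.2 fun z hz =>
      h.notMem_take hn hz (by rw [List.take_of_length_le hB.le]; exact h.sublist.subset hz)
    obtain ⟨B', Inp', eof', h1, h2, -, -⟩ := reach_fresh_run (M := M) (j := .last) h hn
      (B := B) (Inp := []) O (eof := true) (by simp) (by omega) (fun _ => rfl)
    obtain ⟨rfl, rfl⟩ : B' = [] ∧ Inp' = [] := by simpa using h2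
    have hs : Runs M ⟨[], B, O, .drain, false⟩ ⟨[], B, O, .run true true true .last, false⟩ :=
      runs_step fun coin => by
        have : B.length ≤ 2 * M := by omega
        simp [command, exec, hB0, this]
    exact ⟨w, by simpa using h.perm, h.numRuns_le_one,
      Reach.haltsWith (hs.trans h1) (haltsWith_fill_nil hM _)⟩

/-- The coin toss at the start of a block. -/
theorem step_fill {B : List α} (O Inp : List α) (hM : 1 ≤ M) (hB : B.length = M) :
    (upDown α M).step ⟨Inp, B, O, St.fill, false⟩ = (PMF.uniformOfFintype Bool).map fun coin =>
      (⟨Inp, simStart (!coin) B, O, St.sim coin true, false⟩ : Config α St) := by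
  refine (step_upDown Inp B O .fill).trans ?_
  congr 1
  funext coin
  obtain ⟨x, hx⟩ : ∃ x, x ∈ B := List.exists_mem_of_length_pos (by omega)
  obtain ⟨d, hd⟩ := exists_isPick (up := !coin) (o := none) ⟨x, hx, fits_none _ x⟩
  have hlen := List.length_erase_of_mem hd.1
  simp only [command, hB, lt_irrefl, if_false, exec, simStart, pick_eq_some hd]
  rw [if_pos]
  refine ⟨fun z hz => ?_, ?_⟩
  · rcases List.mem_append.1 hz with hz | hz
    · exact hz
    · rcases List.mem_cons.1 hz with rfl | hz
      · exact hd.1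
      · exact List.mem_of_mem_erase hz
  · simp only [List.length_append, List.length_cons, hlen]
    omega

theorem coin_bound_one {a b : ℝ≥0∞} (ha : a ≤ 1) (hb : b ≤ 2) : 2⁻¹ * (a + b) ≤ 7 / 4 := by
  calc 2⁻¹ * (a + b) ≤ 2⁻¹ * (1 + 2) := by gcongr
    _ ≤ 7 / 4 := by
      rw [← ENNReal.toReal_le_toReal (by finiteness) (by finiteness)]
      norm_num [ENNReal.toReal_mul, ENNReal.toReal_add, ENNReal.toReal_div]

theorem coin_bound_two {a b c : ℝ≥0∞} (ha : a ≤ 3 + 7 / 4 * c) (hb : b ≤ 4 + 7 / 4 * c) :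
    2⁻¹ * (a + b) ≤ 7 / 4 * (c + 2) := by
  calc 2⁻¹ * (a + b) ≤ 2⁻¹ * ((3 + 7 / 4 * c) + (4 + 7 / 4 * c)) := by gcongr
    _ = 2⁻¹ * 7 + (2⁻¹ * 2) * (7 / 4 * c) := by ring
    _ = 7 / 4 * (c + 2) := by
      have : (2⁻¹ * 7 : ℝ≥0∞) = 7 / 4 * 2 := by
        rw [← ENNReal.toReal_eq_toReal_iff' (by finiteness) (by finiteness)]
        norm_num [ENNReal.toReal_mul, ENNReal.toReal_div]
      rw [this, ENNReal.inv_mul_cancel (by simp) (by simp)]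
      ring

/-- The competitive ratios, for what is left at the start of a block. -/
theorem exists_haltsWith_fill (hM : 1 ≤ M) (n : ℕ) : ∀ (B Inp O K : List α), B.length ≤ M →
    (B ++ Inp).Sublist K → K.Nodup → Solvable M n K → ∃ q : PMF (List α),
      HaltsWith (upDown α M) ⟨Inp, B, O, St.fill, false⟩ (q.map (O ++ ·)) ∧
      (∀ S ∈ q.support, S.Perm (B ++ Inp) ∧ numRuns S ≤ 2 * n) ∧ expRuns q ≤ 7 / 4 * n := by
  induction n using Nat.strong_induction_on with
  | _ n ih =>
    intro B Inp O K hB hJK hK hs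
    cases n with
    | zero =>
      obtain rfl := hs.eq_nil
      obtain ⟨rfl, rfl⟩ : B = [] ∧ Inp = [] := by simpa using hJK
      refine ⟨PMF.pure [], by simpa [PMF.pure_map] using haltsWith_fill_nil hM O, by simp, ?_⟩
      simp [expRuns_pure]
    | succ n =>
      have hJ := hK.sublist hJK
      rcases runs_fill O B Inp hB with ⟨B₁, Inp₁, hR, hBI, hB₁⟩ | ⟨hlt, hR⟩
      swap
      · obtain ⟨w, hw, hw1, hh⟩ := haltsWith_drain hM O hlt hJ
        refine ⟨PMF.pure w, ?_, ?_, ?_⟩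
        · rw [PMF.pure_map]
          exact Reach.haltsWith hR hh
        · simp only [PMF.support_pure, Set.mem_singleton_iff, forall_eq]
          exact ⟨hw, by omega⟩
        · rw [expRuns_pure]
          calc (numRuns w : ℝ≥0∞) ≤ 1 := by exact_mod_cast hw1
            _ ≤ 7 / 4 := by
              rw [ENNReal.le_div_iff_mul_le (by simp) (by simp)]
              norm_num
            _ ≤ 7 / 4 * ((n + 1 : ℕ) : ℝ≥0∞) :=
              le_mul_of_one_le_right' (by exact_mod_cast Nat.succ_le_succ n.zero_le)
      · obtain ⟨wt, rt, ht⟩ := exists_greedy M true none (B ++ Inp)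
        obtain ⟨wf, rf, hf⟩ := exists_greedy M false none (B ++ Inp)
        rw [← hBI] at ht hf hJK hJ ⊢
        -- what a block and the continuation of the algorithm achieve, for each outcome of the coin
        have hdir : ∀ (up : Bool) {w₁ r₁ wb rb : List α}, Greedy M up none (B₁ ++ Inp₁) w₁ r₁ →
            Greedy M (!up) none (B₁ ++ Inp₁) wb rb → ∃ q : PMF (List α),
            HaltsWith (upDown α M) ⟨Inp₁, simStart (!up) B₁, O, St.sim up true, false⟩
              (q.map (O ++ ·)) ∧
            (∀ S ∈ q.support, S.Perm (B₁ ++ Inp₁) ∧ numRuns S ≤ 2 * (n + 1)) ∧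
            (n = 0 → expRuns q ≤ 2 ∧ (r₁ = [] → expRuns q ≤ 1)) ∧
            expRuns q ≤ 4 + 7 / 4 * (n - 1 : ℕ) ∧
            (r₁.length ≤ rb.length → expRuns q ≤ 3 + 7 / 4 * (n - 1 : ℕ)) := by
          intro up w₁ r₁ wb rb h₁ hb
          obtain ⟨w, B', Inp', K', hR', hperm, hB', hJK', hK', hs', h0, h4, h3⟩ :=
            exists_block hM up O rfl hB₁ hJK hK hs h₁ hb
          obtain ⟨q, hq, hqS, hqE⟩ := ih (n - 1) (by omega) B' Inp' (O ++ w) K' hB' hJK' hK' hs'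
          have hE := expRuns_append_le w q
          have hle : ∀ {k : ℕ}, numRuns w ≤ k →
              expRuns (q.map (w ++ ·)) ≤ k + 7 / 4 * (n - 1 : ℕ) := fun hk =>
            hE.trans (add_le_add (by exact_mod_cast hk) hqE)
          refine ⟨q.map (w ++ ·), ?_, ?_, ?_, by exact_mod_cast hle h4,
            fun h => by exact_mod_cast hle (h3 h)⟩
          · rw [PMF.map_comp]
            rw [show (O ++ ·) ∘ (w ++ ·) = fun S : List α => O ++ w ++ S from
              funext fun S => by simp]
            exact Reach.haltsWith hR' hq
          · intro S hS
            obtain ⟨T, hT, rfl⟩ := (PMF.mem_support_map_iff _ _ _).1 hS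
            obtain ⟨hT1, hT2⟩ := hqS T hT
            refine ⟨(hT1.append_left w).trans hperm, (numRuns_append_le w T).trans ?_⟩
            rcases Nat.eq_zero_or_pos n with hn | hn
            · have := (h0 hn).1
              omega
            · omega
          · rintro rfl
            exact ⟨by simpa using hle (h0 rfl).1, fun h => by simpa using hle ((h0 rfl).2 h)⟩
        obtain ⟨qt, hqt, hqtS, hqt0, hqt4, hqt3⟩ := hdir true ht hf
        obtain ⟨qf, hqf, hqfS, hqf0, hqf4, hqf3⟩ := hdir false hf ht
        refine ⟨(PMF.uniformOfFintype Bool).bind fun i => bif i then qt else qf, ?_, ?_, ?_⟩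
        · refine Reach.haltsWith hR ?_
          rw [PMF.map_bind]
          refine HaltsWith.of_coin (step_fill O Inp₁ hM hB₁) ?_
          rintro (_ | _)
          · exact hqf
          · exact hqt
        · intro S hS
          obtain ⟨i, -, hi⟩ := (PMF.mem_support_bind_iff _ _ _).1 hS
          cases i
          · exact hqfS S hi
          · exact hqtS S hi
        · rw [expRuns_coin]
          simp only [cond_true, cond_false]
          rcases n with _ | n
          · -- A run that an optimal solution could use is chosen with probability `1 / 2`.
            obtain ⟨d, v, K₁, hv, hd, hs₁⟩ := hs.exists_run
            obtain rfl := hs₁.eq_nil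
            simp only [zero_add, Nat.cast_one, mul_one]
            cases d
            · rw [add_comm]
              exact coin_bound_one ((hqf0 rfl).2
                (List.sublist_nil.1 (hf.sublist_of_sublist hd hv hK hJK le_rfl))) (hqt0 rfl).1
            · exact coin_bound_one ((hqt0 rfl).2
                (List.sublist_nil.1 (ht.sublist_of_sublist hd hv hK hJK le_rfl))) (hqf0 rfl).1
          · -- A run that ends no earlier than the opposite one is chosen with probability `1 / 2`.
            have hcast : ((n + 1 + 1 : ℕ) : ℝ≥0∞) = (n : ℝ≥0∞) + 2 := by
              push_cast
              rw [add_assoc, one_add_one_eq_two]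
            rw [hcast]
            rcases le_total rt.length rf.length with hle | hle
            · exact coin_bound_two (hqt3 hle) hqf4
            · rw [add_comm (expRuns qt)]
              exact coin_bound_two (hqf3 hle) hqt4

end Blocks

end RunGen

/-- For every `M ≥ 1` there is a randomized online algorithm with a buffer of `2 M` slots and
`o(M)` bits of internal state which, on every input without duplicates, always writes the whole
input in at most `2 OPT` runs, and in at most `(7/4) OPT` runs in expectation, where `OPT` is the
optimum for a buffer of `M` slots. -/
theorem mainTheorem6 {α : Type*} [LinearOrder α] :
    ∃ A : (M : ℕ) → RunGen.OnlineAlg α (2 * M),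
      ((fun M : ℕ => Real.logb 2 (Fintype.card (A M).State : ℝ))
        =o[Filter.atTop] (fun M : ℕ => (M : ℝ))) ∧
      ∀ M : ℕ, 1 ≤ M → ∀ I : List α, I.Nodup →
        ∃ p : PMF (List α), (A M).HasOutputLaw I p ∧
          (∀ S ∈ p.support, S.Perm I) ∧
          ∑' S : List α, p S * (RunGen.numRuns S : ℝ≥0∞)
            ≤ (7 / 4 : ℝ≥0∞) * (RunGen.opt M I : ℝ≥0∞) ∧
          (∀ S ∈ p.support, RunGen.numRuns S ≤ 2 * RunGen.opt M I) := by
  refine ⟨RunGen.upDown α, ?_, fun M hM I hI => ?_⟩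
  · -- The number of states does not depend on `M`.
    exact (Asymptotics.isLittleO_const_id_atTop
      (Real.logb 2 (Fintype.card RunGen.St : ℝ))).comp_tendsto tendsto_natCast_atTop_atTop
  · obtain ⟨q, ⟨t, h1, h2⟩, hS, hE⟩ := RunGen.exists_haltsWith_fill hM (RunGen.opt M I) [] I [] I
      (by simp) (by simp) hI (RunGen.solvable_opt hM I)
    have hq : q.map (([] : List α) ++ ·) = q := PMF.map_id q
    rw [hq] at h2
    refine ⟨q, ⟨t, ?_, ?_⟩, fun S hSq => by simpa using (hS S hSq).1, hE, fun S hSq => (hS S hSq).2⟩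
    · rw [RunGen.law_eq_lawFrom]
      exact h1
    · rw [RunGen.law_eq_lawFrom]
      exact h2
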